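/- \textbf{Setting.} Let $L$ be a compact Lawson lattice, i.e. a compact Hausdorff distributive topological lattice in which every point has a local base of upper subsemilattices and a local base of lower subsemilattices (so $L$ is complete; $0,1$ are its bottom and top). Let $*:L\times L\to L$ be associative, commutative, isotone in both arguments, with neutral element $1$, distributive over $\lor$ in both arguments, and lower semicontinuous (the preimage of each open upper set is open). Write $\alpha\ll\beta$ if every nonempty directed $D\subset L$ with $\beta\le\sup D$ contains some $\gamma\ge\alpha$. A compactum is a nonempty compact Hausdorff space; $\exp X$ is the set of nonempty closed subsets of $X$ with the Vietoris topology. An \emph{$L$-ambiguous representation} between compacta $X,Y$ is a set $R\subset\exp X\times\exp Y\times L$ such that (a) $(A,B,\alpha)\in R$, $A'\subset A$, $B\subset B'$, $\alpha'\le\alpha$ imply $(A',B',\alpha')\in R$; (b) $(A,B,\alpha),(A,B,\beta)\in R$ imply $(A,B,\alpha\lor\beta)\in R$; (c) $(A,Y,\alpha),(A,B,0)\in R$ for all $A,B,\alpha$; (d) for every $A\in\exp X$ the set $AR=\{(B,\alpha):(A,B,\alpha)\in R\}$ is closed in $\exp Y\times L$. For $R\subset\exp X\times\exp Y\times L$ let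 $R^{\smile}\subset\exp Y\times\exp X\times L$ consist of all $(B,A,\alpha)$ such that $\alpha=0$, or for every $\beta\ll\alpha$ and every $A'\in\exp X$ with $A'\cap A=\varnothing$ there is $B'\in\exp Y$ with $B'\cap B=\varnothing$ and $(A',B',\beta)\in R$. An $L$-ambiguous representation $R$ is \emph{pseudo-invertible} if $(R^{\smile})^{\smile}=R$; then $R^{\smile}$ is called its \emph{pseudo-inverse}. For $R\subset\exp X\times\exp Y\times L$ and $S\subset\exp Y\times\exp Z\times L$ let $R\circledast S$ be the set of all $(A,C,\alpha)\in\exp X\times\exp Z\times L$ such that $$\alpha\le\sup\{\beta*\gamma:\ (A,B,\beta)\in R,\ (B,C,\gamma)\in S\text{ for some }B\in\exp Y\},$$ and let $R\mathbin{\overline{\circledast}}S$ be given by $A(R\mathbin{\overline{\circledast}}S)=\mathrm{Cl}\,(A(R\circledast S))$ for all $A\in\exp X$, with closure in $\exp Z\times L$. \textbf{Proposition.} (1) Let $X,Y,Z$ be compacta and let $R\subset\exp X\times\exp Y\times L$ and $S\subset\exp Y\times\exp Z\times L$ be pseudo-invertible $L$-ambiguous representations. Then $R\mathbin{\overline{\circledast}}S$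 is a pseudo-invertible $L$-ambiguous representation, and its pseudo-inverse is $(R\mathbin{\overline{\circledast}}S)^{\smile}=S^{\smile}\mathbin{\overline{\circledast}}R^{\smile}$. (2) Consequently there is a category $\mathrm{Cpamb}^*_L$ whose objects are the compacta, whose arrows $X\to Y$ are the pseudo-invertible $L$-ambiguous representations between $X$ and $Y$, in which the composite of $R:X\to Y$ followed by $S:Y\to Z$ is $R\mathbin{\overline{\circledast}}S$, and in which the identity of $X$ is $\{(A,B,\alpha):A\subset B\text{ or }\alpha=0\}$. The assignment $X\mapsto X$, $R\mapsto R^{\smile}$ is an involutive anti-isomorphism $(\mathrm{Cpamb}^*_L)^{op}\to\mathrm{Cpamb}^*_L$ which preserves objects. -/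

import Mathlib

open CategoryTheory TopologicalSpace Topology Opposite

universe u u₁ u₂ u₃ v

namespace AmbRep

/-- The hyperspace of all nonempty closed subsets of a compact Hausdorff space (there, closed and
compact subsets coincide). Mathlib's topology on it is the Vietoris topology, its order is
inclusion, and its top element is the whole space. -/
abbrev Exp (X : Type*) [TopologicalSpace X] := NonemptyCompacts X

/-- `IsLawsonLattice L`: with its topology, `L` is a compact Lawson lattice, that is, a compact
Hausdorff distributive topological lattice in which every point has a local base of
upper subsemilattices and a local base of lower subsemilattices.
Compactness forces `L` to be complete, so that the assumption `CompleteLattice L` is no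
restriction; it gives access to `sSup`, `⊥` and `⊤`. -/
class IsLawsonLattice (L : Type*) [CompleteLattice L] [TopologicalSpace L] : Prop
    extends CompactSpace L, T2Space L, TopologicalLattice L where
  inf_sup_distrib : ∀ a b c : L, a ⊓ (b ⊔ c) = (a ⊓ b) ⊔ (a ⊓ c)
  sup_base : ∀ a : L, ∀ U ∈ 𝓝 a, ∃ V ∈ 𝓝 a, V ⊆ U ∧ SupClosed V
  inf_base : ∀ a : L, ∀ U ∈ 𝓝 a, ∃ V ∈ 𝓝 a, V ⊆ U ∧ InfClosed V

/-- The conditions on the operation `*` on `L`: associative, commutative, isotone in both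
arguments, with neutral element `1`, distributive over binary joins in both arguments, and
lower semicontinuous (the preimage of every open upper set is open). -/
structure IsLSCTNorm {L : Type*} [CompleteLattice L] [TopologicalSpace L]
    (star : L → L → L) : Prop where
  assoc : ∀ a b c, star (star a b) c = star a (star b c)
  comm : ∀ a b, star a b = star b a
  mono : ∀ a a' b b', a ≤ a' → b ≤ b' → star a b ≤ star a' b'
  one_star : ∀ a, star ⊤ a = a
  star_one : ∀ a, star a ⊤ = a
  star_sup : ∀ a b c, star a (b ⊔ c) = star a b ⊔ star a c
  sup_star : ∀ a b c, star (a ⊔ b) c = star a c ⊔ star b c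
  lsc : ∀ V : Set L, IsOpen V → IsUpperSet V → IsOpen {p : L × L | star p.1 p.2 ∈ V}

/-- `a ≪ b`: every (nonempty) directed set with `b ≤ sup D` contains an element above `a`. -/
def WayBelow {L : Type*} [CompleteLattice L] (a b : L) : Prop :=
  ∀ D : Set L, D.Nonempty → DirectedOn (· ≤ ·) D → b ≤ sSup D → ∃ c ∈ D, a ≤ c

/-- Subsets of `exp X × exp Y × L`. -/
abbrev Rel (L X Y : Type*) [TopologicalSpace X] [TopologicalSpace Y] :=
  Set (Exp X × Exp Y × L)

section

variable {L X Y Z : Type*} [TopologicalSpace X] [TopologicalSpace Y] [TopologicalSpace Z]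

/-- `AR`, the set of all `(B, α)` with `(A, B, α) ∈ R`. -/
def Rel.sect (R : Rel L X Y) (A : Exp X) : Set (Exp Y × L) :=
  {p | (A, p.1, p.2) ∈ R}

/-- The `α`-cut of `R`. -/
def Rel.cut (R : Rel L X Y) (α : L) : Set (Exp X × Exp Y) :=
  {p | (p.1, p.2, α) ∈ R}

/-- The converse of a crisp relation: `(B, A)` belongs to it iff for every
`A'` disjoint from `A` there is `B'` disjoint from `B` with `(A', B')` in the relation. -/
def crispInv (R : Set (Exp X × Exp Y)) : Set (Exp Y × Exp X) :=
  {p | ∀ A' : Exp X, Disjoint (A' : Set X) (p.2 : Set X) →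
    ∃ B' : Exp Y, (A', B') ∈ R ∧ Disjoint (B' : Set Y) (p.1 : Set Y)}

variable [CompleteLattice L]

/-- `L`-ambiguous representations between `X` and `Y`. -/
structure IsAmb [TopologicalSpace L] [CompactSpace Y] [Nonempty Y] (R : Rel L X Y) : Prop where
  mono : ∀ (A A' : Exp X) (B B' : Exp Y) (α α' : L), A' ≤ A → B ≤ B' → α' ≤ α →
    (A, B, α) ∈ R → (A', B', α') ∈ R
  sup_mem : ∀ (A : Exp X) (B : Exp Y) (α β : L),
    (A, B, α) ∈ R → (A, B, β) ∈ R → (A, B, α ⊔ β) ∈ R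
  top_mem : ∀ (A : Exp X) (α : L), (A, ⊤, α) ∈ R
  bot_mem : ∀ (A : Exp X) (B : Exp Y), (A, B, ⊥) ∈ R
  closed : ∀ A : Exp X, IsClosed (R.sect A)

/-- The converse of `R`: for `α ≠ 0` its `α`-cut is the intersection of the converses of the cuts
`R_β` over all `β ≪ α`; as in every subgraph of an `L`-relation, all triples with `α = 0`
belong to it. -/
def inv (R : Rel L X Y) : Rel L Y X :=
  {p | p.2.2 = ⊥ ∨ ∀ β : L, WayBelow β p.2.2 → (p.1, p.2.1) ∈ crispInv (R.cut β)}

/-- `R` is a pseudo-invertible `L`-ambiguous representation. -/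
structure IsPseudoInvertible [TopologicalSpace L] [CompactSpace Y] [Nonempty Y]
    (R : Rel L X Y) : Prop where
  isAmb : IsAmb R
  inv_inv : inv (inv R) = R

/-- `R'` is the pseudo-inverse of `R`. -/
structure IsPseudoInverse [TopologicalSpace L] [CompactSpace Y] [Nonempty Y]
    (R : Rel L X Y) (R' : Rel L Y X) : Prop where
  isPseudoInvertible : IsPseudoInvertible R
  eq_inv : R' = inv R

/-- The `*`-composition of `L`-relations (first `R`, then `S`), in terms of subgraphs. -/
def preComp (star : L → L → L) (R : Rel L X Y) (S : Rel L Y Z) : Rel L X Z :=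
  {p | p.2.2 ≤ sSup {δ | ∃ (B : Exp Y) (β γ : L),
    (p.1, B, β) ∈ R ∧ (B, p.2.1, γ) ∈ S ∧ δ = star β γ}}

/-- The closure-modified `*`-composition (first `R`, then `S`): every section at `A` of the
`*`-composition is replaced by its closure in `exp Z × L`. -/
def comp [TopologicalSpace L] (star : L → L → L) (R : Rel L X Y) (S : Rel L Y Z) : Rel L X Z :=
  {p | p.2 ∈ closure ((preComp star R S).sect p.1)}

/-- The identity arrow: `(A, B, α)` with `A ⊆ B` or `α = 0`. -/
def unit (L X : Type*) [TopologicalSpace X] [CompleteLattice L] : Rel L X X :=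
  {p | p.1 ≤ p.2.1 ∨ p.2.2 = ⊥}

end

/-- Nonempty compact Hausdorff spaces, as objects of a category. -/
structure Obj : Type (u + 1) where
  carrier : Type u
  [top : TopologicalSpace carrier]
  [compact : CompactSpace carrier]
  [t2 : T2Space carrier]
  [nonempty : Nonempty carrier]

attribute [instance] Obj.top Obj.compact Obj.t2 Obj.nonempty

/-- The set of all pseudo-invertible `L`-ambiguous representations between `X` and `Y`. -/
def Cpamb (L : Type v) [CompleteLattice L] [TopologicalSpace L] (X Y : Obj.{u}) :
    Type (max u v) :=
  {R : Rel L X.carrier Y.carrier // IsPseudoInvertible R}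

end AmbRep

/-! An ambiguous representation is the subgraph of a function `f : Exp X → Exp Y → L`, and
closedness of its sections says that `f A B` is the infimum of `f A D` over the closed
neighbourhoods `D` of `B` (`IsAmb.exists_graph`, `IsAmbFun.isAmb`). In these terms the converse is
the inf-sup formula `invFun` (`inv_graph`), and taking closures of sections becomes an infimum over
neighbourhoods in `compFun` (`comp_graph`).

The converse of a composite then follows from two inequalities: `compFun_invFun_le`, which says g⌣ ∘
f⌣ ≤ (f ∘ g)⌣ and rests on `star` distributing over all suprema, and `IsAmbFun.invFun_invFun_le`,
which says f⌣⌣ ≤ f. For pseudo-invertible f and g, applying the first to f⌣ and g⌣ gives f ∘ g ≤ (g⌣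
∘ f⌣)⌣; one more converse and the second inequality give the reverse bound. Associativity needs a
form of continuity in the first argument, which pseudo-invertibility supplies
(`IsAmbFun.le_iSup_nhd`). -/

namespace AmbRep

/-! ### Order and topology of Lawson lattices; the operation `star` -/

section Lattice

variable {L : Type*} [CompleteLattice L] [TopologicalSpace L] [IsLawsonLattice L]

instance (priority := 50) IsLawsonLattice.orderClosedTopology : OrderClosedTopology L where
  isClosed_le' := by
    have h : {p : L × L | p.1 ≤ p.2} = {p : L × L | p.1 ⊓ p.2 = p.1} := by
      ext p
      simp
    rw [h]
    exact isClosed_eq continuous_inf continuous_fst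

/-- By directedness and compactness the sets `closure D ∩ [d, sSup D]` have a common point; it
bounds `D` from above, so it is the supremum. -/
theorem sSup_mem_closure {D : Set L} (hne : D.Nonempty) (hD : DirectedOn (· ≤ ·) D) :
    sSup D ∈ closure D := by
  have : Nonempty D := hne.to_subtype
  have hcl (d : D) : IsClosed (closure D ∩ Set.Icc d.1 (sSup D)) :=
    isClosed_closure.inter isClosed_Icc
  obtain ⟨x, hx⟩ := IsCompact.nonempty_iInter_of_directed_nonempty_isCompact_isClosed
    (fun d : D => closure D ∩ Set.Icc d.1 (sSup D))
    (by
      intro a b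
      obtain ⟨c, hc, hac, hbc⟩ := hD a a.2 b b.2
      exact ⟨⟨c, hc⟩, Set.inter_subset_inter_right _ (Set.Icc_subset_Icc_left hac),
        Set.inter_subset_inter_right _ (Set.Icc_subset_Icc_left hbc)⟩)
    (fun d => ⟨d, subset_closure d.2, le_rfl, le_sSup d.2⟩)
    (fun d => (hcl d).isCompact) hcl
  rw [Set.mem_iInter] at hx
  have hle : sSup D ≤ x := sSup_le fun d hd => (hx ⟨d, hd⟩).2.1
  obtain ⟨d, hd⟩ := hne
  have hxD := hx ⟨d, hd⟩
  rw [le_antisymm hle hxD.2.2]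
  exact hxD.1

theorem sInf_mem_closure {D : Set L} (hne : D.Nonempty) (hD : InfClosed D) :
    sInf D ∈ closure D := by
  have : Nonempty D := hne.to_subtype
  have hcl (d : D) : IsClosed (closure D ∩ Set.Icc (sInf D) d.1) :=
    isClosed_closure.inter isClosed_Icc
  obtain ⟨x, hx⟩ := IsCompact.nonempty_iInter_of_directed_nonempty_isCompact_isClosed
    (fun d : D => closure D ∩ Set.Icc (sInf D) d.1)
    (by
      intro a b
      exact ⟨⟨a ⊓ b, hD a.2 b.2⟩,
        Set.inter_subset_inter_right _ (Set.Icc_subset_Icc_right inf_le_left),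
        Set.inter_subset_inter_right _ (Set.Icc_subset_Icc_right inf_le_right)⟩)
    (fun d => ⟨d, subset_closure d.2, sInf_le d.2, le_rfl⟩)
    (fun d => (hcl d).isCompact) hcl
  rw [Set.mem_iInter] at hx
  have hle : x ≤ sInf D := le_sInf fun d hd => (hx ⟨d, hd⟩).2.2
  obtain ⟨d, hd⟩ := hne
  have hxD := hx ⟨d, hd⟩
  rw [le_antisymm hxD.2.1 hle]
  exact hxD.1

/-- The greatest lower bound of a neighbourhood of a point is way below that point. -/
theorem wayBelow_sInf {a : L} {V : Set L} (hV : V ∈ 𝓝 a) : WayBelow (sInf V) a := by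
  intro D hne hD ha
  have hcont : Filter.Tendsto (fun x => a ⊓ x) (𝓝 (sSup D)) (𝓝 a) := by
    have h : Continuous fun x : L => a ⊓ x := by fun_prop
    simpa [inf_eq_left.2 ha] using h.tendsto (sSup D)
  obtain ⟨d, hdV, hd⟩ := mem_closure_iff_nhds.1 (sSup_mem_closure hne hD) _ (hcont hV)
  exact ⟨d, hd, (sInf_le (Set.mem_preimage.1 hdV)).trans inf_le_right⟩

/-- Every point is a limit of elements way below it: if `V` is a small meet-closed neighbourhood,
`sInf V` stays in its closure and is way below the point. -/
theorem le_of_forall_wayBelow {a u : L} (h : ∀ b, WayBelow b a → b ≤ u) : a ≤ u := by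
  suffices a ∈ closure (Set.Iic u) by rwa [isClosed_Iic.closure_eq] at this
  rw [mem_closure_iff_nhds]
  intro U hU
  obtain ⟨W, hW, hWc, hWU⟩ := exists_mem_nhds_isClosed_subset hU
  obtain ⟨V, hV, hVW, hinf⟩ := IsLawsonLattice.inf_base a W hW
  exact ⟨sInf V, hWU (closure_minimal hVW hWc
    (sInf_mem_closure ⟨a, mem_of_mem_nhds hV⟩ hinf)), h _ (wayBelow_sInf hV)⟩

namespace IsLSCTNorm

variable {star : L → L → L}

omit [IsLawsonLattice L] in
theorem star_bot (hs : IsLSCTNorm star) (a : L) : star a ⊥ = ⊥ :=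
  le_bot_iff.1 ((hs.mono _ ⊤ _ ⊥ le_top le_rfl).trans (hs.one_star ⊥).le)

/-- Distributivity over binary joins makes `{y | star a y ≤ u}` directed, and lower semicontinuity
makes it closed, so it contains its supremum. Since `ι` is any sort, possibly empty, this also
applies to suprema over proofs. -/
theorem star_iSup_le (hs : IsLSCTNorm star) {ι : Sort*} {a u : L} {x : ι → L} (h : ∀ i, star a (x i) ≤ u) :
    star a (⨆ i, x i) ≤ u := by
  set D : Set L := {y | star a y ≤ u}
  have hne : D.Nonempty := ⟨⊥, by simp [D, hs.star_bot]⟩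
  have hdir : DirectedOn (· ≤ ·) D := fun y hy z hz =>
    ⟨y ⊔ z, (hs.star_sup a y z).trans_le (sup_le hy hz), le_sup_left, le_sup_right⟩
  refine (hs.mono _ _ _ _ le_rfl (iSup_le fun i => le_sSup (show x i ∈ D from h i))).trans ?_
  by_contra hn
  have hup : IsUpperSet (Set.Iic u)ᶜ := (isLowerSet_Iic u).compl
  have hopen := hs.lsc _ isClosed_Iic.isOpen_compl hup
  have hopen' : IsOpen {y | star a y ∈ (Set.Iic u)ᶜ} :=
    hopen.preimage (by fun_prop : Continuous fun y : L => (a, y))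
  obtain ⟨y, hy, hyD⟩ := mem_closure_iff.1 (sSup_mem_closure hne hdir) _ hopen' hn
  exact hy hyD

theorem iSup_star_le (hs : IsLSCTNorm star) {ι : Sort*} {a u : L} {x : ι → L} (h : ∀ i, star (x i) a ≤ u) :
    star (⨆ i, x i) a ≤ u := by
  rw [hs.comm]
  exact hs.star_iSup_le fun i => (hs.comm _ _).trans_le (h i)

omit [IsLawsonLattice L] in
theorem bot_star (hs : IsLSCTNorm star) (a : L) : star ⊥ a = ⊥ := by rw [hs.comm, hs.star_bot]

end IsLSCTNorm

end Lattice

/-! ### Closed neighbourhoods in the hyperspace -/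

section Hyperspace

variable {X : Type*} [TopologicalSpace X]

/-- `D` is a closed neighbourhood of `B`. -/
def IsNhd (B D : Exp X) : Prop := (B : Set X) ⊆ interior (D : Set X)

theorem IsNhd.le {B D : Exp X} (h : IsNhd B D) : B ≤ D :=
  fun _ hx => interior_subset (h hx)

theorem IsNhd.mono {B B' D : Exp X} (hB : B' ≤ B) (h : IsNhd B D) : IsNhd B' D :=
  fun _ hx => h (hB hx)

variable [CompactSpace X]

theorem isNhd_top [Nonempty X] (B : Exp X) : IsNhd B ⊤ := by
  simp [IsNhd]

/-- The complement of the interior of a set, as an element of the hyperspace. -/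
def complInterior (D : Exp X) (h : interior (D : Set X) ≠ Set.univ) : Exp X where
  carrier := (interior (D : Set X))ᶜ
  isCompact' := isOpen_interior.isClosed_compl.isCompact
  nonempty' := Set.nonempty_compl.2 h

theorem IsNhd.disjoint_complInterior {B D : Exp X} (h : IsNhd B D)
    (hD : interior (D : Set X) ≠ Set.univ) :
    Disjoint (complInterior D hD : Set X) (B : Set X) :=
  Set.disjoint_left.2 fun _ hx hB => hx (h hB)

theorem le_of_disjoint_complInterior {B D : Exp X} (hD : interior (D : Set X) ≠ Set.univ)
    (h : Disjoint (B : Set X) (complInterior D hD : Set X)) : B ≤ D := by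
  intro x hx
  by_contra hn
  exact Set.disjoint_left.1 h hx fun hi => hn (interior_subset hi)

theorem eq_top_of_interior_eq [Nonempty X] {D : Exp X}
    (h : interior (D : Set X) = Set.univ) : D = ⊤ :=
  NonemptyCompacts.ext (Set.eq_univ_of_univ_subset (h.symm.trans_subset interior_subset))

variable [T2Space X]

theorem exists_isNhd_subset {B : Exp X} {U : Set X} (hU : IsOpen U) (hB : (B : Set X) ⊆ U) :
    ∃ D : Exp X, IsNhd B D ∧ (D : Set X) ⊆ U := by
  obtain ⟨V, hV, hBV, hVU⟩ := normal_exists_closure_subset B.isCompact.isClosed hU hB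
  exact ⟨⟨⟨closure V, isClosed_closure.isCompact⟩, (B.nonempty.mono hBV).closure⟩,
    hBV.trans (interior_maximal subset_closure hV), hVU⟩

theorem exists_isNhd_disjoint {A B : Exp X} (h : Disjoint (A : Set X) (B : Set X)) :
    ∃ D : Exp X, IsNhd B D ∧ Disjoint (A : Set X) (D : Set X) := by
  obtain ⟨D, hD, hDA⟩ := exists_isNhd_subset A.isCompact.isClosed.isOpen_compl
    (Set.subset_compl_iff_disjoint_left.2 h)
  exact ⟨D, hD, Set.subset_compl_iff_disjoint_left.1 hDA⟩

theorem IsNhd.exists_between {B D : Exp X} (h : IsNhd B D) :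
    ∃ E : Exp X, IsNhd B E ∧ IsNhd E D :=
  exists_isNhd_subset isOpen_interior h

omit [CompactSpace X] [T2Space X] in
theorem eventually_le_of_isNhd {B D : Exp X} (h : IsNhd B D) : ∀ᶠ E in 𝓝 B, E ≤ D := by
  have hopen : IsOpen {E : Exp X | (E : Set X) ⊆ interior (D : Set X)} :=
    NonemptyCompacts.isOpen_subsets_of_isOpen isOpen_interior
  filter_upwards [hopen.mem_nhds h] with E hE
  exact IsNhd.le hE

/-- In a basic Vietoris set only the condition of lying in the union bounds a set from above, and
normality leaves room there; the hitting conditions survive enlargement. -/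
theorem exists_isNhd_mem {B : Exp X} {U : Set (Exp X)} (hU : U ∈ 𝓝 B) :
    ∃ D : Exp X, IsNhd B D ∧ D ∈ U := by
  let : TopologicalSpace (Set X) := TopologicalSpace.vietoris X
  rw [NonemptyCompacts.isEmbedding_coe.nhds_eq_comap] at hU
  obtain ⟨W, hW, hWU⟩ := hU
  obtain ⟨_, ⟨u, ⟨-, hu⟩, rfl⟩, ⟨hBu, hBi⟩, huW⟩ :=
    vietoris.isTopologicalBasis.mem_nhds_iff.1 hW
  obtain ⟨D, hD, hDu⟩ := exists_isNhd_subset (isOpen_sUnion hu) hBu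
  exact ⟨D, hD, hWU (huW ⟨hDu, fun V hV =>
    (hBi V hV).mono (Set.inter_subset_inter_left _ hD.le)⟩)⟩

end Hyperspace

/-! ### Representations as `L`-valued functions: converse and composition -/

section Functions

variable {L X Y Z W : Type*} [TopologicalSpace X] [TopologicalSpace Y] [TopologicalSpace Z]
  [TopologicalSpace W] [CompleteLattice L]

/-- The subgraph of an `L`-valued relation. -/
def graph (f : Exp X → Exp Y → L) : Rel L X Y := {p | p.2.2 ≤ f p.1 p.2.1}

theorem mem_graph {f : Exp X → Exp Y → L} {A : Exp X} {B : Exp Y} {α : L} :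
    (A, B, α) ∈ graph f ↔ α ≤ f A B := Iff.rfl

theorem graph_injective : Function.Injective (graph : (Exp X → Exp Y → L) → Rel L X Y) := by
  intro f g h
  funext A B
  exact le_antisymm (mem_graph.1 (h ▸ mem_graph.2 le_rfl : (A, B, f A B) ∈ graph g))
    (mem_graph.1 (h ▸ mem_graph.2 le_rfl : (A, B, g A B) ∈ graph f))

/-- The functions whose subgraphs are the `L`-ambiguous representations. -/
structure IsAmbFun [CompactSpace Y] [Nonempty Y] (f : Exp X → Exp Y → L) : Prop where
  anti : ∀ {A A' : Exp X} (B : Exp Y), A' ≤ A → f A B ≤ f A' B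
  mono : ∀ (A : Exp X) {B B' : Exp Y}, B ≤ B' → f A B ≤ f A B'
  top : ∀ A : Exp X, f A ⊤ = ⊤
  le_of_nhd : ∀ (A : Exp X) (B : Exp Y) (a : L), (∀ D, IsNhd B D → a ≤ f A D) → a ≤ f A B

/-- The converse of an `L`-valued relation. -/
def invFun (f : Exp X → Exp Y → L) (B : Exp Y) (A : Exp X) : L :=
  ⨅ (A' : Exp X) (_ : Disjoint (A' : Set X) (A : Set X)),
    ⨆ (B' : Exp Y) (_ : Disjoint (B' : Set Y) (B : Set Y)), f A' B'

/-- The regularized composition of `L`-valued relations. -/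
def compFun (star : L → L → L) (f : Exp X → Exp Y → L) (g : Exp Y → Exp Z → L)
    (A : Exp X) (C : Exp Z) : L :=
  ⨅ (D : Exp Z) (_ : IsNhd C D), ⨆ B : Exp Y, star (f A B) (g B D)

theorem invFun_le {f : Exp X → Exp Y → L} {B : Exp Y} {A A' : Exp X}
    (h : Disjoint (A' : Set X) (A : Set X)) :
    invFun f B A ≤ ⨆ (B' : Exp Y) (_ : Disjoint (B' : Set Y) (B : Set Y)), f A' B' :=
  iInf₂_le A' h

theorem invFun_mono {f g : Exp X → Exp Y → L} (h : f ≤ g) : invFun f ≤ invFun g :=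
  fun _ _ => iInf₂_mono fun A' _ => iSup₂_mono fun B' _ => h A' B'

theorem compFun_le {star : L → L → L} {f : Exp X → Exp Y → L} {g : Exp Y → Exp Z → L}
    {A : Exp X} {C D : Exp Z} (h : IsNhd C D) :
    compFun star f g A C ≤ ⨆ B : Exp Y, star (f A B) (g B D) :=
  iInf₂_le D h

/-- Nothing is asked of `f`: the value at `⊤` is an empty infimum, and normality gives regularity by
separating `A` from each `A'` by a neighbourhood. -/
theorem isAmbFun_invFun [CompactSpace X] [T2Space X] [Nonempty X] (f : Exp X → Exp Y → L) :
    IsAmbFun (invFun f) where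
  anti A hB := iInf₂_mono fun A' _ => iSup₂_le fun B' hB' =>
    le_iSup₂_of_le B' (hB'.mono_right hB) le_rfl
  mono B A₁ A₂ hA := le_iInf₂ fun A' hA' => invFun_le (hA'.mono_right hA)
  top B := top_le_iff.1 <| le_iInf₂ fun A' hA' => by
    obtain ⟨x, hx⟩ := A'.nonempty
    exact (Set.disjoint_left.1 hA' hx (Set.mem_univ x)).elim
  le_of_nhd B A a h := le_iInf₂ fun A' hA' => by
    obtain ⟨D, hD, hAD⟩ := exists_isNhd_disjoint hA'
    exact (h D hD).trans (invFun_le hAD)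

/-- Test the outer converse on the complement of the interior of a neighbourhood `D` of `B`:
whatever is disjoint from it lies in `D`. If that complement is empty, then `D = ⊤`. -/
theorem IsAmbFun.invFun_invFun_le [CompactSpace Y] [Nonempty Y]
    {f : Exp X → Exp Y → L} (hf : IsAmbFun f) : invFun (invFun f) ≤ f := by
  intro A B
  refine hf.le_of_nhd _ _ _ fun D hD => ?_
  by_cases hi : interior (D : Set Y) = Set.univ
  · rw [eq_top_of_interior_eq hi, hf.top]
    exact le_top
  · exact (invFun_le (hD.disjoint_complInterior hi)).trans <| iSup₂_le fun A' hA' =>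
      (invFun_le hA'.symm).trans <| iSup₂_le fun B' hB' =>
        hf.mono A (le_of_disjoint_complInterior hi hB')

/-- Invertible functions are continuous from above in the first argument, up to passing to
neighbourhoods in the second one. -/
theorem IsAmbFun.le_iSup_nhd [CompactSpace X] [T2Space X] [Nonempty X]
    [CompactSpace Y] [Nonempty Y] {f : Exp X → Exp Y → L}
    (hf : IsAmbFun f) (hinv : invFun (invFun f) = f) (A : Exp X) {B D : Exp Y} (hD : IsNhd B D) :
    f A B ≤ ⨆ (E : Exp X) (_ : IsNhd A E), f E D := by
  by_cases hi : interior (D : Set Y) = Set.univ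
  · rw [eq_top_of_interior_eq hi]
    exact le_iSup₂_of_le ⊤ (isNhd_top A) (le_top.trans (hf.top _).ge)
  · rw [← congrFun (congrFun hinv A) B]
    refine (invFun_le (hD.disjoint_complInterior hi)).trans <| iSup₂_le fun A' hA' => ?_
    obtain ⟨E, hE, hAE⟩ := exists_isNhd_disjoint hA'
    exact le_iSup₂_of_le E hE <| (invFun_le hAE.symm).trans <| iSup₂_le fun B' hB' =>
      hf.mono E (le_of_disjoint_complInterior hi hB')

section Topological

variable [TopologicalSpace L] [IsLawsonLattice L]

theorem IsAmbFun.isAmb [CompactSpace Y] [T2Space Y] [Nonempty Y] {f : Exp X → Exp Y → L}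
    (hf : IsAmbFun f) : IsAmb (graph f) where
  mono A A' B B' α α' hA hB hα h :=
    hα.trans ((mem_graph.1 h).trans ((hf.anti B hA).trans (hf.mono A' hB)))
  sup_mem _ _ _ _ h h' := sup_le h h'
  top_mem A _ := mem_graph.2 (le_top.trans (hf.top A).ge)
  bot_mem _ _ := mem_graph.2 bot_le
  closed A := by
    refine isClosed_of_closure_subset ?_
    rintro ⟨B, α⟩ h
    refine hf.le_of_nhd A B α fun D hD => ?_
    suffices α ∈ closure (Set.Iic (f A D)) by rwa [isClosed_Iic.closure_eq] at this
    rw [mem_closure_iff_nhds]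
    intro U hU
    obtain ⟨⟨E, β⟩, ⟨hE, hβ⟩, hm⟩ := mem_closure_iff_nhds.1 h _
      (prod_mem_nhds (eventually_le_of_isNhd hD) hU)
    exact ⟨β, hβ, (mem_graph.1 hm).trans (hf.mono A hE)⟩

theorem IsAmb.exists_graph [CompactSpace Y] [T2Space Y] [Nonempty Y] {R : Rel L X Y}
    (hR : IsAmb R) : ∃ f : Exp X → Exp Y → L, IsAmbFun f ∧ R = graph f := by
  let S (A : Exp X) (B : Exp Y) : Set L := {α | (A, B, α) ∈ R}
  have hS (A : Exp X) (B : Exp Y) : sSup (S A B) ∈ S A B := by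
    have hc : IsClosed (S A B) :=
      (hR.closed A).preimage (by fun_prop : Continuous fun α : L => (B, α))
    have := sSup_mem_closure (D := S A B) ⟨⊥, hR.bot_mem A B⟩ fun α hα β hβ =>
      ⟨α ⊔ β, hR.sup_mem A B α β hα hβ, le_sup_left, le_sup_right⟩
    rwa [hc.closure_eq] at this
  have hle {A : Exp X} {B : Exp Y} {α : L} : α ≤ sSup (S A B) ↔ (A, B, α) ∈ R :=
    ⟨fun h => hR.mono A A B B _ _ le_rfl le_rfl h (hS A B), fun h => le_sSup h⟩
  refine ⟨fun A B => sSup (S A B), ⟨fun {A A'} B hA => ?_, fun A {B B'} hB => ?_, fun A => ?_,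
    fun A B a h => ?_⟩, ?_⟩
  · exact hle.2 (hR.mono A A' B B _ _ hA le_rfl le_rfl (hS A B))
  · exact hle.2 (hR.mono A A B B' _ _ le_rfl hB le_rfl (hS A B))
  · exact top_le_iff.1 (hle.2 (hR.top_mem A ⊤))
  · refine hle.2 ?_
    have hc : IsClosed {B : Exp Y | (A, B, a) ∈ R} :=
      (hR.closed A).preimage (by fun_prop : Continuous fun B : Exp Y => (B, a))
    suffices B ∈ closure {B : Exp Y | (A, B, a) ∈ R} by rwa [hc.closure_eq] at this
    rw [mem_closure_iff_nhds]
    intro U hU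
    obtain ⟨D, hD, hDU⟩ := exists_isNhd_mem hU
    exact ⟨D, hDU, hle.1 (h D hD)⟩
  · ext ⟨A, B, α⟩
    exact hle.symm

/-- The way-below relation turns a bound by a supremum into a single witness `B'`, because the sets
disjoint from `B` are closed under union and `f` is isotone in its second argument. -/
theorem inv_graph [CompactSpace Y] [Nonempty Y] {f : Exp X → Exp Y → L} (hf : IsAmbFun f) :
    inv (graph f) = graph (invFun f) := by
  ext ⟨B, A, α⟩
  constructor
  · rintro (h | h)
    · exact mem_graph.2 ((le_of_eq h).trans bot_le)
    · refine le_iInf₂ fun A' hA' => le_of_forall_wayBelow fun β hβ => ?_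
      obtain ⟨B', hm, hB'⟩ := h β hβ A' hA'
      exact le_iSup₂_of_le B' hB' hm
  · intro h
    refine or_iff_not_imp_left.2 fun hα β hβ A' hA' => ?_
    have hle : α ≤ sSup (f A' '' {B' : Exp Y | Disjoint (B' : Set Y) (B : Set Y)}) := by
      rw [sSup_image]
      exact (mem_graph.1 h).trans (invFun_le hA')
    -- If no nonempty closed set misses `B`, the supremum is `⊥`; this is the case that `α = ⊥`
    -- absorbs.
    obtain ⟨_, ⟨B', hB', rfl⟩, hc⟩ := hβ _ (by
      by_contra hn
      rw [Set.not_nonempty_iff_eq_empty.1 hn, sSup_empty] at hle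
      exact hα (le_bot_iff.1 hle)) (by
      rintro _ ⟨B₁, h₁, rfl⟩ _ ⟨B₂, h₂, rfl⟩
      exact ⟨_, ⟨B₁ ⊔ B₂, Set.disjoint_union_left.2 ⟨h₁, h₂⟩, rfl⟩,
        hf.mono A' le_sup_left, hf.mono A' le_sup_right⟩) hle
    exact ⟨B', hc, hB'⟩

variable {star : L → L → L}

theorem comp_graph [CompactSpace Y] [CompactSpace Z] [T2Space Z] [Nonempty Y] [Nonempty Z]
    (hs : IsLSCTNorm star)
    {f : Exp X → Exp Y → L} {g : Exp Y → Exp Z → L} (hg : IsAmbFun g) :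
    comp star (graph f) (graph g) = graph (compFun star f g) := by
  have hpre (A : Exp X) (C : Exp Z) (α : L) : (C, α) ∈ (preComp star (graph f) (graph g)).sect A ↔
      α ≤ ⨆ B : Exp Y, star (f A B) (g B C) := by
    have : sSup {δ | ∃ (B : Exp Y) (β γ : L), (A, B, β) ∈ graph f ∧ (B, C, γ) ∈ graph g ∧
        δ = star β γ} = ⨆ B : Exp Y, star (f A B) (g B C) := by
      refine le_antisymm (sSup_le ?_) (iSup_le fun B => le_sSup ⟨B, _, _, ?_, ?_, rfl⟩)
      · rintro _ ⟨B, β, γ, hβ, hγ, rfl⟩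
        exact le_iSup_of_le B (hs.mono _ _ _ _ hβ hγ)
      · exact mem_graph.2 le_rfl
      · exact mem_graph.2 le_rfl
    rw [← this]
    rfl
  ext ⟨A, C, α⟩
  constructor
  · intro h
    refine le_iInf₂ fun D hD => ?_
    suffices α ∈ closure (Set.Iic (⨆ B : Exp Y, star (f A B) (g B D))) by
      rwa [isClosed_Iic.closure_eq] at this
    rw [mem_closure_iff_nhds]
    intro U hU
    obtain ⟨⟨E, β⟩, ⟨hE, hβ⟩, hm⟩ := mem_closure_iff_nhds.1 h _
      (prod_mem_nhds (eventually_le_of_isNhd hD) hU)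
    exact ⟨β, hβ, ((hpre A E β).1 hm).trans
      (iSup_mono fun B => hs.mono _ _ _ _ le_rfl (hg.mono B hE))⟩
  · intro h
    refine mem_closure_iff_nhds.2 fun U hU => ?_
    obtain ⟨V, hV, V', hV', hVU⟩ := mem_nhds_prod_iff.1 hU
    obtain ⟨D, hD, hDV⟩ := exists_isNhd_mem hV
    exact ⟨(D, α), hVU ⟨hDV, mem_of_mem_nhds hV'⟩,
      (hpre A D α).2 ((mem_graph.1 h).trans (compFun_le hD))⟩

omit [IsLawsonLattice L] in
theorem le_compFun (hs : IsLSCTNorm star) [CompactSpace Z] [Nonempty Z]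
    (f : Exp X → Exp Y → L) {g : Exp Y → Exp Z → L} (hg : IsAmbFun g)
    (A : Exp X) (B : Exp Y) (C : Exp Z) : star (f A B) (g B C) ≤ compFun star f g A C :=
  le_iInf₂ fun _ hD => le_iSup_of_le B (hs.mono _ _ _ _ le_rfl (hg.mono B hD.le))

omit [IsLawsonLattice L] in
theorem isAmbFun_compFun (hs : IsLSCTNorm star) [CompactSpace Y] [Nonempty Y]
    [CompactSpace Z] [T2Space Z] [Nonempty Z]
    {f : Exp X → Exp Y → L} {g : Exp Y → Exp Z → L} (hf : IsAmbFun f) (hg : IsAmbFun g) :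
    IsAmbFun (compFun star f g) where
  anti C hA := iInf₂_mono fun D _ => iSup_mono fun B => hs.mono _ _ _ _ (hf.anti B hA) le_rfl
  mono A C C' hC := le_iInf₂ fun D hD => compFun_le (hD.mono hC)
  top A := by
    have h := le_compFun hs f hg A ⊤ ⊤
    rwa [hf.top, hg.top, hs.one_star, top_le_iff] at h
  le_of_nhd A C a h := le_iInf₂ fun D hD => by
    obtain ⟨E, hE, hED⟩ := hD.exists_between
    exact (h E hE).trans (compFun_le hED)

/-- The set `B'` disjoint from `B` that the bound on `invFun f B D` provides is also a test set for
`invFun g C B`, so it can serve as the middle term of `compFun star f g`. Commutativity of `star`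
repairs the reversed order. -/
theorem compFun_invFun_le (hs : IsLSCTNorm star) [CompactSpace X] [T2Space X]
    [CompactSpace Z] [Nonempty Z]
    (f : Exp X → Exp Y → L) {g : Exp Y → Exp Z → L} (hg : IsAmbFun g) :
    compFun star (invFun g) (invFun f) ≤ invFun (compFun star f g) := by
  intro C A
  refine le_iInf₂ fun A' hA' => ?_
  -- The regularized composite is controlled only on neighbourhoods of `A`, so one still disjoint
  -- from `A'` is chosen.
  obtain ⟨D, hD, hAD⟩ := exists_isNhd_disjoint hA'
  refine (compFun_le hD).trans <| iSup_le fun B => ?_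
  refine (hs.mono _ _ _ _ le_rfl (invFun_le hAD)).trans ?_
  refine hs.star_iSup_le fun B' => hs.star_iSup_le fun hB' => ?_
  refine (hs.mono _ _ _ _ (invFun_le hB') le_rfl).trans ?_
  refine hs.iSup_star_le fun C' => hs.iSup_star_le fun hC' => ?_
  refine le_iSup₂_of_le C' hC' ?_
  rw [hs.comm]
  exact le_compFun hs f hg A' B' C'

theorem invFun_compFun (hs : IsLSCTNorm star) [CompactSpace X] [T2Space X] [Nonempty X]
    [CompactSpace Y] [T2Space Y] [Nonempty Y] [CompactSpace Z] [T2Space Z] [Nonempty Z]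
    {f : Exp X → Exp Y → L} {g : Exp Y → Exp Z → L} (hg : IsAmbFun g)
    (hfi : invFun (invFun f) = f) (hgi : invFun (invFun g) = g) :
    invFun (compFun star f g) = compFun star (invFun g) (invFun f) := by
  refine le_antisymm ?_ (compFun_invFun_le hs f hg)
  have h := compFun_invFun_le hs (invFun g) (isAmbFun_invFun f)
  rw [hfi, hgi] at h
  exact (invFun_mono h).trans
    (isAmbFun_compFun hs (isAmbFun_invFun g) (isAmbFun_invFun f)).invFun_invFun_le

theorem compFun_assoc (hs : IsLSCTNorm star) [CompactSpace Y] [T2Space Y] [Nonempty Y]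
    [CompactSpace Z] [T2Space Z] [Nonempty Z] [CompactSpace W] [T2Space W] [Nonempty W]
    {f : Exp X → Exp Y → L} {g : Exp Y → Exp Z → L} {h : Exp Z → Exp W → L}
    (hg : IsAmbFun g) (hh : IsAmbFun h) (hhi : invFun (invFun h) = h) :
    compFun star (compFun star f g) h = compFun star f (compFun star g h) := by
  funext A K
  refine le_antisymm (le_iInf₂ fun D hD => ?_) (le_iInf₂ fun D hD => ?_)
  · obtain ⟨E, hE, hED⟩ := hD.exists_between
    refine (compFun_le hE).trans <| iSup_le fun C => ?_
    -- The inner composite at `C` is bounded by unregularized values only at neighbourhoods `C'` of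
    -- `C`; pseudo-invertibility of `h` moves its first argument from `C` to such a `C'`, at the
    -- cost of enlarging `E` to `D`.
    refine (hs.mono _ _ _ _ le_rfl (hh.le_iSup_nhd hhi C hED)).trans ?_
    refine hs.star_iSup_le fun C' => hs.star_iSup_le fun hC' => ?_
    refine (hs.mono _ _ _ _ (compFun_le hC') le_rfl).trans ?_
    refine hs.iSup_star_le fun B => ?_
    rw [hs.assoc]
    exact le_iSup_of_le B (hs.mono _ _ _ _ le_rfl (le_compFun hs g hh B C' D))
  · obtain ⟨E, hE, hED⟩ := hD.exists_between
    refine (compFun_le hE).trans <| iSup_le fun B => ?_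
    refine (hs.mono _ _ _ _ le_rfl (compFun_le hED)).trans ?_
    refine hs.star_iSup_le fun C => ?_
    rw [← hs.assoc]
    exact le_iSup_of_le C (hs.mono _ _ _ _ (le_compFun hs f hg A B C) le_rfl)

end Topological

/-! ### The identity arrow -/

open Classical in
/-- The characteristic function of inclusion. -/
noncomputable def unitFun (L X : Type*) [TopologicalSpace X] [CompleteLattice L] (A B : Exp X) : L :=
  if A ≤ B then ⊤ else ⊥

theorem graph_unitFun : graph (unitFun L X) = unit L X := by
  ext ⟨A, B, α⟩
  by_cases h : A ≤ B <;> simp [graph, unit, unitFun, h]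

theorem unitFun_eq_top {A B : Exp X} (h : A ≤ B) : unitFun L X A B = ⊤ := if_pos h

theorem unitFun_eq_bot {A B : Exp X} (h : ¬ A ≤ B) : unitFun L X A B = ⊥ := if_neg h

theorem invFun_unitFun [T2Space X] : invFun (unitFun L X) = unitFun L X := by
  funext B A
  by_cases h : B ≤ A
  · rw [unitFun_eq_top h, ← top_le_iff]
    refine le_iInf₂ fun A' hA' => le_iSup₂_of_le A' (hA'.mono_right h) ?_
    rw [unitFun_eq_top le_rfl]
  · rw [unitFun_eq_bot h, ← le_bot_iff]
    obtain ⟨x, hxB, hxA⟩ := Set.not_subset.1 h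
    -- The test set is a point `x` of `B` outside `A`: no set disjoint from `B` contains it.
    refine (invFun_le (A' := {x}) (Set.disjoint_singleton_left.2 hxA)).trans <|
      iSup₂_le fun B' hB' => ?_
    rw [unitFun_eq_bot fun hle => Set.disjoint_left.1 hB' (hle rfl) hxB]

/-- The function is its own converse, and every converse has the required properties. -/
theorem isAmbFun_unitFun [CompactSpace X] [T2Space X] [Nonempty X] : IsAmbFun (unitFun L X) :=
  invFun_unitFun (L := L) (X := X) ▸ isAmbFun_invFun (unitFun L X)

variable [TopologicalSpace L] [IsLawsonLattice L] {star : L → L → L}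

omit [IsLawsonLattice L] in
theorem unitFun_compFun (hs : IsLSCTNorm star) [CompactSpace Y] [Nonempty Y]
    {f : Exp X → Exp Y → L} (hf : IsAmbFun f) : compFun star (unitFun L X) f = f := by
  funext A C
  refine le_antisymm (hf.le_of_nhd _ _ _ fun D hD => ?_) ?_
  · refine (compFun_le hD).trans <| iSup_le fun B => ?_
    by_cases h : A ≤ B
    · rw [unitFun_eq_top h, hs.one_star]
      exact hf.anti D h
    · rw [unitFun_eq_bot h, hs.bot_star]
      exact bot_le
  · have h := le_compFun hs (unitFun L X) hf A A C
    rwa [unitFun_eq_top le_rfl, hs.one_star] at h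

omit [IsLawsonLattice L] in
theorem compFun_unitFun (hs : IsLSCTNorm star) [CompactSpace Y] [T2Space Y] [Nonempty Y]
    {f : Exp X → Exp Y → L} (hf : IsAmbFun f) : compFun star f (unitFun L Y) = f := by
  funext A C
  refine le_antisymm (hf.le_of_nhd _ _ _ fun D hD => ?_) ?_
  · refine (compFun_le hD).trans <| iSup_le fun B => ?_
    by_cases h : B ≤ D
    · rw [unitFun_eq_top h, hs.star_one]
      exact hf.mono A h
    · rw [unitFun_eq_bot h, hs.star_bot]
      exact bot_le
  · have h := le_compFun hs f isAmbFun_unitFun A C C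
    rwa [unitFun_eq_top le_rfl, hs.star_one] at h

end Functions

/-! ### Transfer back to relations -/

section Relations

variable {L X Y Z W : Type*} [CompleteLattice L] [TopologicalSpace L] [IsLawsonLattice L]
  [TopologicalSpace X] [CompactSpace X] [T2Space X] [Nonempty X]
  [TopologicalSpace Y] [CompactSpace Y] [T2Space Y] [Nonempty Y]
  [TopologicalSpace Z] [CompactSpace Z] [T2Space Z] [Nonempty Z]
  [TopologicalSpace W] [CompactSpace W] [T2Space W] [Nonempty W]
  {star : L → L → L} {R : Rel L X Y} {S : Rel L Y Z} {T : Rel L Z W}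

theorem IsAmbFun.isPseudoInvertible {f : Exp X → Exp Y → L} (hf : IsAmbFun f)
    (hi : invFun (invFun f) = f) : IsPseudoInvertible (graph f) where
  isAmb := hf.isAmb
  inv_inv := by rw [inv_graph hf, inv_graph (isAmbFun_invFun f), hi]

theorem IsPseudoInvertible.exists_graph (hR : IsPseudoInvertible R) :
    ∃ f : Exp X → Exp Y → L, IsAmbFun f ∧ invFun (invFun f) = f ∧ R = graph f := by
  obtain ⟨f, hf, rfl⟩ := hR.isAmb.exists_graph
  have h := hR.inv_inv
  rw [inv_graph hf, inv_graph (isAmbFun_invFun f)] at h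
  exact ⟨f, hf, graph_injective h, rfl⟩

theorem IsPseudoInvertible.inv (hR : IsPseudoInvertible R) : IsPseudoInvertible (inv R) := by
  obtain ⟨f, hf, hfi, rfl⟩ := hR.exists_graph
  rw [inv_graph hf]
  exact (isAmbFun_invFun f).isPseudoInvertible (by rw [hfi])

theorem isPseudoInvertible_unit : IsPseudoInvertible (unit L X) := by
  rw [← graph_unitFun]
  exact isAmbFun_unitFun.isPseudoInvertible (by rw [invFun_unitFun, invFun_unitFun])

theorem inv_unit : AmbRep.inv (unit L X) = unit L X := by
  rw [← graph_unitFun, inv_graph isAmbFun_unitFun, invFun_unitFun]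

theorem IsPseudoInvertible.inv_comp (hs : IsLSCTNorm star) (hR : IsPseudoInvertible R)
    (hS : IsPseudoInvertible S) :
    AmbRep.inv (comp star R S) = comp star (AmbRep.inv S) (AmbRep.inv R) := by
  obtain ⟨f, hf, hfi, rfl⟩ := hR.exists_graph
  obtain ⟨g, hg, hgi, rfl⟩ := hS.exists_graph
  rw [comp_graph hs hg, inv_graph (isAmbFun_compFun hs hf hg), inv_graph hf, inv_graph hg,
    comp_graph hs (isAmbFun_invFun f), invFun_compFun hs hg hfi hgi]

theorem IsPseudoInvertible.comp (hs : IsLSCTNorm star) (hR : IsPseudoInvertible R)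
    (hS : IsPseudoInvertible S) : IsPseudoInvertible (comp star R S) where
  isAmb := by
    obtain ⟨f, hf, -, rfl⟩ := hR.exists_graph
    obtain ⟨g, hg, -, rfl⟩ := hS.exists_graph
    rw [comp_graph hs hg]
    exact (isAmbFun_compFun hs hf hg).isAmb
  inv_inv := by
    rw [hR.inv_comp hs hS, hS.inv.inv_comp hs hR.inv, hR.inv_inv, hS.inv_inv]

theorem IsPseudoInvertible.comp_assoc (hs : IsLSCTNorm star) (hR : IsPseudoInvertible R)
    (hS : IsPseudoInvertible S) (hT : IsPseudoInvertible T) :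
    AmbRep.comp star (AmbRep.comp star R S) T = AmbRep.comp star R (AmbRep.comp star S T) := by
  obtain ⟨f, hf, -, rfl⟩ := hR.exists_graph
  obtain ⟨g, hg, -, rfl⟩ := hS.exists_graph
  obtain ⟨h, hh, hhi, rfl⟩ := hT.exists_graph
  rw [comp_graph hs hg, comp_graph hs hh, comp_graph hs hh,
    comp_graph hs (isAmbFun_compFun hs hg hh), compFun_assoc hs hg hh hhi]

omit [T2Space X] in
theorem IsAmb.unit_comp (hs : IsLSCTNorm star) (hR : IsAmb R) :
    AmbRep.comp star (unit L X) R = R := by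
  obtain ⟨f, hf, rfl⟩ := hR.exists_graph
  rw [← graph_unitFun, comp_graph hs hf, unitFun_compFun hs hf]

omit [CompactSpace X] [T2Space X] [Nonempty X] in
theorem IsAmb.comp_unit (hs : IsLSCTNorm star) (hR : IsAmb R) :
    AmbRep.comp star R (unit L Y) = R := by
  obtain ⟨f, hf, rfl⟩ := hR.exists_graph
  rw [← graph_unitFun, comp_graph hs isAmbFun_unitFun, compFun_unitFun hs hf]

end Relations

/-! ### The category and its involution -/

/-- The category of compacta and pseudo-invertible `L`-ambiguous representations. -/
@[reducible]
def category {L : Type v} [CompleteLattice L] [TopologicalSpace L] [IsLawsonLattice L]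
    {star : L → L → L} (hs : IsLSCTNorm star) : Category.{max u v} Obj.{u} where
  Hom X Y := Cpamb L X Y
  id _ := ⟨unit L _, isPseudoInvertible_unit⟩
  comp f g := ⟨comp star f.1 g.1, f.2.comp hs g.2⟩
  id_comp f := Subtype.ext (f.2.isAmb.unit_comp hs)
  comp_id f := Subtype.ext (f.2.isAmb.comp_unit hs)
  assoc f g h := Subtype.ext (f.2.comp_assoc hs g.2 h.2)

/-- The involution of the category of compacta that sends every arrow to its pseudo-inverse. -/
def invFunctor {L : Type v} [CompleteLattice L] [TopologicalSpace L] [IsLawsonLattice L]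
    {star : L → L → L} (hs : IsLSCTNorm star) :
    letI := category.{u} hs
    Obj.{u}ᵒᵖ ⥤ Obj.{u} :=
  letI := category.{u} hs
  { obj := fun X => X.unop
    map := fun f => ⟨inv f.unop.1, f.unop.2.inv⟩
    map_id := fun _ => Subtype.ext inv_unit
    map_comp := fun f g => Subtype.ext (g.unop.2.inv_comp hs f.unop.2) }

end AmbRep

theorem mainTheorem8 {L : Type v} [CompleteLattice L] [TopologicalSpace L]
    [AmbRep.IsLawsonLattice L] (star : L → L → L) (hstar : AmbRep.IsLSCTNorm star) :
    -- the composition of pseudo-invertible representations and its pseudo-inverse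
    (∀ (X : Type u₁) (Y : Type u₂) (Z : Type u₃)
      [TopologicalSpace X] [CompactSpace X] [T2Space X] [Nonempty X]
      [TopologicalSpace Y] [CompactSpace Y] [T2Space Y] [Nonempty Y]
      [TopologicalSpace Z] [CompactSpace Z] [T2Space Z] [Nonempty Z]
      (R : AmbRep.Rel L X Y) (S : AmbRep.Rel L Y Z),
      AmbRep.IsPseudoInvertible R → AmbRep.IsPseudoInvertible S →
        AmbRep.IsPseudoInvertible (AmbRep.comp star R S) ∧
        AmbRep.IsPseudoInverse (AmbRep.comp star R S)
          (AmbRep.comp star (AmbRep.inv S) (AmbRep.inv R))) ∧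
    -- the category of compacta and pseudo-invertible representations
    ∃ (_ : Category.{max u v} AmbRep.Obj.{u})
      (e : ∀ X Y : AmbRep.Obj.{u}, (X ⟶ Y) ≃ AmbRep.Cpamb L X Y),
      (∀ X : AmbRep.Obj.{u}, (e X X (𝟙 X)).1 = AmbRep.unit L X.carrier) ∧
      (∀ (X Y Z : AmbRep.Obj.{u}) (f : X ⟶ Y) (g : Y ⟶ Z),
        (e X Z (f ≫ g)).1 = AmbRep.comp star (e X Y f).1 (e Y Z g).1) ∧
      -- the involutive anti-isomorphism, which preserves objects
      ∃ (F : AmbRep.Obj.{u}ᵒᵖ ⥤ AmbRep.Obj.{u}) (hF : ∀ X : AmbRep.Obj.{u}, F.obj (op X) = X),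
        (∀ (X Y : AmbRep.Obj.{u}) (f : X ⟶ Y),
          (e Y X (eqToHom (hF Y).symm ≫ F.map f.op ≫ eqToHom (hF X))).1 =
            AmbRep.inv (e X Y f).1) ∧
        F.rightOp ⋙ F = 𝟭 AmbRep.Obj.{u} ∧
        F ⋙ F.rightOp = 𝟭 AmbRep.Obj.{u}ᵒᵖ := by
  refine ⟨?_, ?_⟩
  · intro X Y Z _ _ _ _ _ _ _ _ _ _ _ _ R S hR hS
    exact ⟨hR.comp hstar hS, hR.comp hstar hS, (hR.inv_comp hstar hS).symm⟩
  · let := AmbRep.category.{u} hstar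
    refine ⟨AmbRep.category.{u} hstar, fun X Y => Equiv.refl _, fun X => rfl,
      fun X Y Z f g => rfl, AmbRep.invFunctor.{u} hstar, fun X => rfl, fun X Y f => ?_,
      Functor.hext (fun X => rfl) fun X Y f => heq_of_eq (Subtype.ext f.2.inv_inv),
      Functor.hext (fun X => rfl) fun X Y f =>
        heq_of_eq (Quiver.Hom.unop_inj (Subtype.ext f.unop.2.inv_inv))⟩
    -- The functor fixes objects definitionally, so both `eqToHom` factors are identities.
    let g : Y ⟶ X := ⟨AmbRep.inv f.1, f.2.inv⟩
    have h : 𝟙 Y ≫ g ≫ 𝟙 X = g := by rw [Category.id_comp, Category.comp_id]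
    exact congrArg Subtype.val h
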